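/- Let $D\subset\mathbb{C}^n$ be a bounded strongly pseudoconvex domain, that is, a bounded, nonempty, connected open set for which there is a $C^2$ function $\psi\colon\mathbb{C}^n\to\mathbb{R}$ with $D=\{\psi<0\}$, $d\psi\neq 0$ at every point of $\partial D$, and $$\sum_{i,j=1}^n\frac{\partial^2\psi}{\partial z_i\partial\bar z_j}(p)\,v_i\bar v_j>0$$ for all $p\in\partial D$ and all $v\in\mathbb{C}^n\setminus\{0\}$ with $\sum_j\frac{\partial\psi}{\partial z_j}(p)\,v_j=0$. Let $k_D$ be the Kobayashi distance of $D$, that is, the largest pseudodistance on $D$ that is bounded above by the Lempert function $$\delta_D(z,w)=\inf\{k_\Delta(\zeta,\eta)\mid \text{there is a holomorphic }\varphi\colon\Delta\to D\text{ with }\varphi(\zeta)=z,\ \varphi(\eta)=w\},$$ where $k_\Delta(\zeta,\eta)=\operatorname{artanh}\left|\frac{\zeta-\eta}{1-\bar\eta\zeta}\right|$ is the Poincaré distance of the unit disk $\Delta\subset\mathbb{C}$; equivalently, $k_D(z,w)$ is the infimum of $\sum_{i=0}^{m-1}\delta_D(p_i,p_{i+1})$ over all finite chains $z=p_0,p_1,\dots,p_m=w$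 in $D$. Endow $D$ with the distance $\rho_D=\tanh k_D$. Let $d(z,\partial D)$ denote the Euclidean distance of $z$ from the boundary of $D$. Let $\Gamma=\{z_j\}\subset D$ be a (finite or infinite) sequence that is uniformly discrete, that is, there is $\delta>0$ with $\rho_D(z_j,z_k)\ge\delta$ for all $j\ne k$, and assume that $d(z_j,\partial D)<1$ for all $j$. Then $$\sum_{z_j\in\Gamma} d(z_j,\partial D)^{n}\,h\left(-\frac{1}{\log d(z_j,\partial D)}\right)<+\infty$$ for every (weakly) increasing function $h\colon\mathbb{R}^+\to\mathbb{R}^+$ (defined at least on $(0,+\infty)$, with values in $[0,+\infty)$) such that $$\sum_{m=1}^{+\infty}h\left(\frac1m\right)<+\infty.$$ -/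

import Mathlib

open scoped ENNReal

noncomputable section

/-- The Poincaré distance of the unit disk,
`k_Δ(ζ, η) = artanh r = (1/2) log ((1 + r) / (1 - r))` with `r = |ζ - η| / |1 - conj η * ζ|`. -/
def poincareDist (ζ η : ℂ) : ℝ :=
  Real.artanh ‖(ζ - η) / (1 - (starRingEnd ℂ) η * ζ)‖

/-- The Lempert function of `D ⊆ ℂⁿ`: the infimum of `k_Δ(ζ, η)` over all holomorphic maps
`φ : Δ → D` and all `ζ, η ∈ Δ` with `φ ζ = z`, `φ η = w` (it is `∞` if there are none). -/
def lempertFunction {n : ℕ} (D : Set (EuclideanSpace ℂ (Fin n)))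
    (z w : EuclideanSpace ℂ (Fin n)) : ℝ≥0∞ :=
  ⨅ (φ : ℂ → EuclideanSpace ℂ (Fin n)) (ζ : ℂ) (η : ℂ)
    (_ : DifferentiableOn ℂ φ (Metric.ball 0 1))
    (_ : Set.MapsTo φ (Metric.ball 0 1) D)
    (_ : ζ ∈ Metric.ball (0 : ℂ) 1) (_ : η ∈ Metric.ball (0 : ℂ) 1)
    (_ : φ ζ = z) (_ : φ η = w), ENNReal.ofReal (poincareDist ζ η)

/-- The Kobayashi pseudodistance of `D`, with values in `[0, ∞]`: the largest pseudodistance on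
`D` bounded above by the Lempert function, that is, the infimum over all chains
`z = p 0, p 1, …, p m = w` of points of `D` of the sums of the Lempert function along the chain. -/
def kobayashiEDist {n : ℕ} (D : Set (EuclideanSpace ℂ (Fin n)))
    (z w : EuclideanSpace ℂ (Fin n)) : ℝ≥0∞ :=
  ⨅ (m : ℕ) (p : ℕ → EuclideanSpace ℂ (Fin n)) (_ : ∀ i, p i ∈ D)
    (_ : p 0 = z) (_ : p m = w), ∑ i ∈ Finset.range m, lempertFunction D (p i) (p (i + 1))

/-- The Kobayashi pseudodistance `k_D` as a real number. For a connected open set `D` and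
`z, w ∈ D` the value of `kobayashiEDist D z w` is finite. -/
def kobayashiDist {n : ℕ} (D : Set (EuclideanSpace ℂ (Fin n)))
    (z w : EuclideanSpace ℂ (Fin n)) : ℝ :=
  (kobayashiEDist D z w).toReal

/-- The distance `ρ_D = tanh k_D`. -/
def rhoDist {n : ℕ} (D : Set (EuclideanSpace ℂ (Fin n)))
    (z w : EuclideanSpace ℂ (Fin n)) : ℝ :=
  Real.tanh (kobayashiDist D z w)

/-- A family of points is uniformly discrete for the distance `d` if there is `δ > 0` with
`d (x j) (x k) ≥ δ` for all `j ≠ k`. -/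
def IsUniformlyDiscrete {X ι : Type*} (d : X → X → ℝ) (x : ι → X) : Prop :=
  ∃ δ : ℝ, 0 < δ ∧ ∀ j k : ι, j ≠ k → δ ≤ d (x j) (x k)

/-- The Levi form `∑ ∂²ψ/∂z_i∂z̄_j (p) v_i conj(v_j)` of a real `C²` function `ψ`, written through
the real Hessian `H` of `ψ` at `p` as `(H(v, v) + H(iv, iv)) / 4`. -/
def leviForm {n : ℕ} (ψ : EuclideanSpace ℂ (Fin n) → ℝ) (p v : EuclideanSpace ℂ (Fin n)) : ℝ :=
  (1 / 4) * (fderiv ℝ (fderiv ℝ ψ) p v v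
    + fderiv ℝ (fderiv ℝ ψ) p (Complex.I • v) (Complex.I • v))

/-- The value `∂ψ_p(v) = ∑ ∂ψ/∂z_j (p) v_j` of the `(1,0)`-part of `dψ_p`, that is,
`(dψ_p(v) - i dψ_p(iv)) / 2`. -/
def delForm {n : ℕ} (ψ : EuclideanSpace ℂ (Fin n) → ℝ) (p v : EuclideanSpace ℂ (Fin n)) : ℂ :=
  (1 / 2) * ((fderiv ℝ ψ p v : ℂ) - Complex.I * (fderiv ℝ ψ p (Complex.I • v) : ℂ))

/-- `ψ` is a `C²` defining function of `D`: `D = {ψ < 0}` and `dψ` has no zero on `∂D`. -/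
structure IsDefiningFunction {n : ℕ} (ψ : EuclideanSpace ℂ (Fin n) → ℝ)
    (D : Set (EuclideanSpace ℂ (Fin n))) : Prop where
  contDiff : ContDiff ℝ 2 ψ
  eq_sublevel : D = {z | ψ z < 0}
  fderiv_ne_zero : ∀ p ∈ frontier D, fderiv ℝ ψ p ≠ 0

/-- `D` is a bounded strongly pseudoconvex domain: a bounded domain (nonempty, open, connected)
with `C²` boundary whose Levi form is positive definite on the complex tangent space
`{v | ∂ψ_p(v) = 0}` at each boundary point `p`. -/
structure IsBoundedStronglyPseudoconvexDomain {n : ℕ}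
    (D : Set (EuclideanSpace ℂ (Fin n))) : Prop where
  isOpen : IsOpen D
  isConnected : IsConnected D
  isBounded : Bornology.IsBounded D
  exists_defining : ∃ ψ : EuclideanSpace ℂ (Fin n) → ℝ, IsDefiningFunction ψ D ∧
    ∀ p ∈ frontier D, ∀ v : EuclideanSpace ℂ (Fin n), v ≠ 0 → delForm ψ p v = 0 →
      0 < leviForm ψ p v

end

/-!
Around a point `z` at distance `d` from the boundary, take the box of size `c d` in the complex
normal direction and `√(c d)` in the complex tangential ones. By Taylor's formula a defining
function varies by less than its own size on such a box, so the box lies in `D`, and in fact in a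
collar of `∂D` of width comparable to `d`. The affine complex discs through `z` in the box show
that a box smaller by a constant factor lies in a small Kobayashi ball about `z`; hence the smaller
boxes around the points of a uniformly discrete sequence are disjoint. Each has volume comparable to
`d ^ (n + 1)` while the collar has volume at most comparable to `d`, so there are at most
`K * t ^ (-n)` points at distance comparable to `t` from the boundary. Summing over the shells
`t = e ^ (-m)`, the shell `m` contributes at most `K * h (1 / m)`.
-/

open Metric Set MeasureTheory Module
open scoped Topology NNReal

section Packing

theorem card_mul_le_measure_of_pairwiseDisjoint {α ι : Type*} [MeasurableSpace α] {μ : Measure α}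
    {F : Finset ι} {B : ι → Set α} {S : Set α} {m : ℝ≥0∞} (hmeas : ∀ j ∈ F, MeasurableSet (B j))
    (hdisj : (F : Set ι).PairwiseDisjoint B) (hsub : ∀ j ∈ F, B j ⊆ S)
    (hm : ∀ j ∈ F, m ≤ μ (B j)) : F.card * m ≤ μ S :=
  calc F.card * m = ∑ _j ∈ F, m := by rw [Finset.sum_const, nsmul_eq_mul]
    _ ≤ ∑ j ∈ F, μ (B j) := Finset.sum_le_sum hm
    _ = μ (⋃ j ∈ F, B j) := (measure_biUnion_finset hdisj hmeas).symm
    _ ≤ μ S := measure_mono (iUnion₂_subset hsub)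

end Packing

section Frontier

theorem nonempty_frontier_of_isBounded {E : Type*} [NormedAddCommGroup E] [NormedSpace ℝ E]
    [Nontrivial E] {D : Set E} (hne : D.Nonempty) (hb : Bornology.IsBounded D) :
    (frontier D).Nonempty :=
  nonempty_frontier_iff.2 ⟨hne, fun h => NormedSpace.unbounded_univ ℝ E (h ▸ hb)⟩

theorem infDist_frontier_pos {X : Type*} [PseudoMetricSpace X] {D : Set X} (hD : IsOpen D)
    (hne : (frontier D).Nonempty) {z : X} (hz : z ∈ D) : 0 < infDist z (frontier D) :=
  (isClosed_frontier.notMem_iff_infDist_pos hne).1 fun hz' =>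
    hD.inter_frontier_eq.subset ⟨hz, hz'⟩

theorem infDist_frontier_le_dist {E : Type*} [NormedAddCommGroup E] [NormedSpace ℝ E]
    [FiniteDimensional ℝ E] {D : Set E} {z y : E} (hz : z ∈ D) (hy : y ∉ D) :
    infDist z (frontier D) ≤ dist z y := by
  obtain ⟨x, hx, hxd⟩ := exists_mem_frontier_infDist_compl_eq_dist hz
    (by rintro rfl; exact hy (mem_univ y))
  calc infDist z (frontier D) ≤ dist z x := infDist_le_dist_of_mem hx
    _ = infDist z Dᶜ := hxd.symm
    _ ≤ dist z y := infDist_le_dist_of_mem hy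

end Frontier

/-- `ψ` grows at unit rate along the vector `g` inside `U`. Near a regular point of a `C¹` function
this holds for a suitable `g` and replaces the straightening of its level sets. -/
def GrowsAlong {E : Type*} [AddCommGroup E] [Module ℝ E] (ψ : E → ℝ) (g : E) (U : Set E) : Prop :=
  ∀ ⦃x : E⦄, x ∈ U → ∀ ⦃s : ℝ⦄, 0 ≤ s → x + s • g ∈ U → ψ x + s ≤ ψ (x + s • g)

section GrowsAlong

variable {E : Type*} [NormedAddCommGroup E] [NormedSpace ℝ E] {ψ : E → ℝ} {g p : E} {r : ℝ}

theorem exists_growsAlong_ball {f' : E →L[ℝ] ℝ} (hψ : HasStrictFDerivAt ψ f' p) (hf' : f' ≠ 0) :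
    ∃ (g : E) (r : ℝ), 0 < r ∧ GrowsAlong ψ g (ball p r) := by
  obtain ⟨v, hv⟩ : ∃ v, f' v ≠ 0 := by
    by_contra! h
    exact hf' (ContinuousLinearMap.ext h)
  set g : E := (2 / f' v) • v
  have hg : f' g = 2 := by rw [map_smul, smul_eq_mul, div_mul_cancel₀ _ hv]
  set c : ℝ≥0 := (‖g‖₊ + 1)⁻¹
  have hcg : c * ‖g‖ ≤ 1 := by
    rw [NNReal.coe_inv, NNReal.coe_add, coe_nnnorm, NNReal.coe_one, inv_mul_le_one₀ (by positivity)]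
    exact (lt_add_one _).le
  obtain ⟨U, hU, happrox⟩ := hψ.approximates_deriv_on_nhds (c := c) (Or.inr (by positivity))
  obtain ⟨r, hr, hrU⟩ := Metric.mem_nhds_iff.1 hU
  refine ⟨g, r, hr, fun x hx s hs hxs => ?_⟩
  have happrox_g : |ψ (x + s • g) - ψ x - 2 * s| ≤ s := by
    have h := happrox _ (hrU hxs) _ (hrU hx)
    rw [add_sub_cancel_left, map_smul, hg, norm_smul, Real.norm_of_nonneg hs, smul_eq_mul,
      mul_comm s 2, Real.norm_eq_abs] at h
    nlinarith
  linarith [(abs_le.1 happrox_g).1]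

theorem exists_growsAlong_ball_of_contDiff (hψ : ContDiff ℝ 1 ψ) (hp : fderiv ℝ ψ p ≠ 0) :
    ∃ (g : E) (r : ℝ), 0 < r ∧ GrowsAlong ψ g (ball p r) :=
  exists_growsAlong_ball (hψ.contDiffAt.hasStrictFDerivAt one_ne_zero) hp

theorem preimage_sub_smul_ball_subset {s : ℝ} (hs : 0 ≤ s) (hs1 : s ≤ 1) :
    (fun x => x - s • g) ⁻¹' ball p r ⊆ ball p (r + ‖g‖) := by
  intro x hx
  have hsg : ‖s • g‖ ≤ ‖g‖ := by
    rw [norm_smul, Real.norm_of_nonneg hs]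
    exact mul_le_of_le_one_left (norm_nonneg g) hs1
  calc dist x p ≤ dist (x - s • g) p + dist x (x - s • g) := by
        rw [add_comm]
        exact dist_triangle _ _ _
    _ < r + ‖g‖ := by
      rw [dist_self_sub_right]
      exact add_lt_add_of_lt_of_le hx hsg

namespace GrowsAlong

theorem disjoint_preimage_sub_smul {U : Set E} {a b s t : ℝ} (hg : GrowsAlong ψ g U)
    (hst : s + (b - a) ≤ t) (hab : a < b) :
    Disjoint ((fun x => x - s • g) ⁻¹' (U ∩ ψ ⁻¹' Ioo a b))
      ((fun x => x - t • g) ⁻¹' (U ∩ ψ ⁻¹' Ioo a b)) := by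
  refine Set.disjoint_left.2 fun x ⟨hxs, _, hxsb⟩ ⟨hxt, hxta, _⟩ => ?_
  have hx : x - t • g + (t - s) • g = x - s • g := by module
  have hgrow := hg hxt (s := t - s) (by linarith [sub_pos.2 hab]) (by rwa [hx])
  rw [hx] at hgrow
  linarith

/-- The translates of the slab by the multiples of `(b - a) • g` are disjoint, and about
`(b - a)⁻¹` of them fit into the larger ball. -/
theorem measure_inter_preimage_Ioo_le [MeasurableSpace E] [BorelSpace E] (μ : Measure E)
    [μ.IsAddLeftInvariant] (hg : GrowsAlong ψ g (ball p r)) (hψ : Measurable ψ) {a b : ℝ}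
    (hab : a < b) :
    μ (ball p r ∩ ψ ⁻¹' Ioo a b) ≤ ENNReal.ofReal (b - a) * μ (ball p (r + ‖g‖)) := by
  set τ := b - a
  have hτ0 : 0 < τ := sub_pos.2 hab
  set slab := ball p r ∩ ψ ⁻¹' Ioo a b
  have hslab : MeasurableSet slab := measurableSet_ball.inter (hψ measurableSet_Ioo)
  let N := ⌊τ⁻¹⌋₊
  have hcard : (Finset.range (N + 1)).card * μ slab ≤ μ (ball p (r + ‖g‖)) := by
    refine card_mul_le_measure_of_pairwiseDisjoint
      (B := fun k : ℕ => (fun x => x - (k * τ) • g) ⁻¹' slab)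
      (fun k _ => measurable_sub_const _ hslab) ?_ ?_ ?_
    · intro k _ l _ hkl
      wlog hlt : k < l generalizing k l
      · exact (this (by assumption) (by assumption) hkl.symm (by omega)).symm
      refine hg.disjoint_preimage_sub_smul ?_ hab
      have : (k : ℝ) + 1 ≤ l := by exact_mod_cast hlt
      nlinarith
    · intro k hk
      have hkτ : k * τ ≤ 1 := by
        rw [← le_div_iff₀ hτ0, one_div]
        exact (Nat.le_floor_iff (by positivity)).1 (Nat.lt_succ_iff.1 (Finset.mem_range.1 hk))
      exact (preimage_mono inter_subset_left).trans
        (preimage_sub_smul_ball_subset (by positivity) hkτ)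
    · intro k _
      simp only [sub_eq_add_neg, measure_preimage_add_right, le_refl]
  have hone : 1 ≤ ENNReal.ofReal τ * (Finset.range (N + 1)).card := by
    rw [Finset.card_range, ← ENNReal.ofReal_natCast, ← ENNReal.ofReal_mul hτ0.le,
      ENNReal.one_le_ofReal, mul_comm, ← div_le_iff₀ hτ0, one_div]
    exact_mod_cast (Nat.lt_floor_add_one τ⁻¹).le
  calc μ slab
    _ ≤ ENNReal.ofReal τ * (Finset.range (N + 1)).card * μ slab := le_mul_of_one_le_left' hone
    _ = ENNReal.ofReal τ * ((Finset.range (N + 1)).card * μ slab) := mul_assoc _ _ _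
    _ ≤ ENNReal.ofReal τ * μ (ball p (r + ‖g‖)) := by gcongr

theorem infDist_frontier_le [FiniteDimensional ℝ E] (hg : GrowsAlong ψ g (ball p r))
    (hp : p ∈ frontier {x | ψ x < 0}) {z : E} (hz : ψ z < 0) (hzp : z ∈ ball p (r / 2)) :
    infDist z (frontier {x | ψ x < 0}) ≤ ‖g‖ * -ψ z := by
  have hstep : dist z (z + -ψ z • g) = ‖g‖ * -ψ z := by
    rw [dist_self_add_right, norm_smul, Real.norm_of_nonneg (by linarith), mul_comm]
  rw [mem_ball] at hzp
  by_cases hball : z + -ψ z • g ∈ ball p r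
  · have hgrow := hg (mem_ball.2 (by linarith [dist_nonneg (x := z) (y := p)])) (by linarith) hball
    rw [← hstep]
    exact infDist_frontier_le_dist hz (by rw [mem_ofPred_eq]; linarith)
  · have hdist := dist_triangle_left p (z + -ψ z • g) z
    rw [mem_ball, not_lt, dist_comm] at hball
    linarith [infDist_le_dist_of_mem (x := z) hp]

end GrowsAlong

end GrowsAlong

section SublevelSet

theorem eq_zero_of_mem_frontier_sublevel {X : Type*} [TopologicalSpace X] {ψ : X → ℝ}
    (hψ : Continuous ψ) {p : X} (hp : p ∈ frontier {x | ψ x < 0}) : ψ p = 0 :=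
  frontier_lt_subset_eq hψ continuous_const hp

theorem exists_forall_le_mul_of_eventually {X : Type*} [TopologicalSpace X] {S : Set X}
    {f g : X → ℝ} (hS : IsCompact (closure S)) (hg : ∀ x ∈ S, 0 ≤ g x)
    (hloc : ∀ p ∈ closure S, ∃ C, ∀ᶠ x in 𝓝[S] p, f x ≤ C * g x) :
    ∃ C, 0 < C ∧ ∀ x ∈ S, f x ≤ C * g x := by
  suffices h : ∃ C, 0 < C ∧ ∀ x ∈ closure S, x ∈ S → f x ≤ C * g x by
    obtain ⟨C, hC, h⟩ := h
    exact ⟨C, hC, fun x hx => h x (subset_closure hx) hx⟩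
  refine hS.induction_on ⟨1, one_pos, by simp⟩ ?_ ?_ fun p hp => ?_
  · rintro s t hst ⟨C, hC, h⟩
    exact ⟨C, hC, fun x hx => h x (hst hx)⟩
  · rintro s t ⟨C, hC, hs⟩ ⟨C', -, ht⟩
    refine ⟨max C C', lt_max_of_lt_left hC, fun x hx hxS => ?_⟩
    rcases hx with hx | hx
    · exact (hs x hx hxS).trans (mul_le_mul_of_nonneg_right (le_max_left C C') (hg x hxS))
    · exact (ht x hx hxS).trans (mul_le_mul_of_nonneg_right (le_max_right C C') (hg x hxS))
  · obtain ⟨C, hC⟩ := hloc p hp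
    refine ⟨_, mem_nhdsWithin_of_mem_nhds (eventually_nhdsWithin_iff.1 hC), max C 1, by positivity,
      fun x hx hxS => ?_⟩
    exact (hx hxS).trans (mul_le_mul_of_nonneg_right (le_max_left C 1) (hg x hxS))

theorem exists_mem_nhds_measure_collar_le_of_neg {X : Type*} [TopologicalSpace X]
    [MeasurableSpace X] (μ : Measure X) [IsLocallyFiniteMeasure μ] {ψ : X → ℝ} (hψ : Continuous ψ)
    {p : X} (hp : ψ p < 0) :
    ∃ s ∈ 𝓝 p, ∃ C : ℝ≥0, ∀ t, 0 < t → μ (s ∩ ψ ⁻¹' Ioo (-t) 0) ≤ C * ENNReal.ofReal t := by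
  obtain ⟨s, hs, hμs⟩ := μ.finiteAt_nhds p
  obtain ⟨c, hpc, hc⟩ := exists_between hp
  have hc' : 0 < -c := neg_pos.2 hc
  refine ⟨s ∩ {x | ψ x < c},
    Filter.inter_mem hs ((isOpen_lt hψ continuous_const).mem_nhds hpc),
    (μ s).toNNReal * (-c)⁻¹.toNNReal, fun t _ => ?_⟩
  rcases le_or_gt t (-c) with htc | htc
  · have hempty : s ∩ {x | ψ x < c} ∩ ψ ⁻¹' Ioo (-t) 0 = ∅ := by
      refine eq_empty_of_forall_notMem fun x ⟨⟨_, hxc⟩, hxt, _⟩ => ?_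
      have : ψ x < c := hxc
      linarith
    rw [hempty, measure_empty]
    exact zero_le
  · calc μ (s ∩ {x | ψ x < c} ∩ ψ ⁻¹' Ioo (-t) 0)
      _ ≤ μ s := measure_mono (inter_subset_left.trans inter_subset_left)
      _ ≤ μ s * (ENNReal.ofReal (-c)⁻¹ * ENNReal.ofReal t) := by
        refine le_mul_of_one_le_right' ?_
        rw [← ENNReal.ofReal_mul (by positivity), ENNReal.one_le_ofReal]
        exact (one_le_inv_mul₀ hc').2 htc.le
      _ = ((μ s).toNNReal * (-c)⁻¹.toNNReal : ℝ≥0) * ENNReal.ofReal t := by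
        rw [ENNReal.coe_mul, ENNReal.coe_toNNReal hμs.ne, mul_assoc, ENNReal.ofReal]

variable {E : Type*} [NormedAddCommGroup E] [NormedSpace ℝ E] [FiniteDimensional ℝ E] {ψ : E → ℝ}

/-- Near an interior point `-ψ` is bounded below, and near a boundary point `ψ` grows along some
vector. -/
theorem exists_infDist_frontier_le_mul_neg (hψ : ContDiff ℝ 1 ψ)
    (hreg : ∀ p ∈ frontier {x | ψ x < 0}, fderiv ℝ ψ p ≠ 0)
    (hb : Bornology.IsBounded {x | ψ x < 0}) :
    ∃ C, 0 < C ∧ ∀ z, ψ z < 0 → infDist z (frontier {x | ψ x < 0}) ≤ C * -ψ z := by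
  have := FiniteDimensional.proper_real E
  refine exists_forall_le_mul_of_eventually (S := {x | ψ x < 0}) hb.isCompact_closure
    (fun z hz => neg_nonneg.2 (LT.lt.le hz)) fun p hp => ?_
  rw [closure_eq_self_union_frontier] at hp
  rcases hp with hp | hp
  · set δ : E → ℝ := fun z => infDist z (frontier {x | ψ x < 0})
    have hp0 : ψ p < 0 := hp
    have hcont : Continuous fun z => (δ p / -ψ p + 1) * -ψ z - δ z :=
      (hψ.continuous.neg.const_mul _).sub (continuous_infDist_pt _)
    have hpos : 0 < (δ p / -ψ p + 1) * -ψ p - δ p := by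
      rw [add_mul, div_mul_cancel₀ _ (by linarith)]
      linarith
    refine ⟨δ p / -ψ p + 1, eventually_nhdsWithin_of_eventually_nhds ?_⟩
    filter_upwards [(hcont.tendsto p).eventually_const_lt hpos] with z hz
    exact (sub_pos.1 hz).le
  · obtain ⟨g, r, hr, hg⟩ := exists_growsAlong_ball_of_contDiff hψ (hreg p hp)
    refine ⟨‖g‖, eventually_nhdsWithin_iff.2 ?_⟩
    filter_upwards [ball_mem_nhds p (half_pos hr)] with z hz hz0
    exact hg.infDist_frontier_le hp hz0 hz

theorem exists_neg_le_mul_infDist_frontier (hψ : ContDiff ℝ 1 ψ)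
    (hb : Bornology.IsBounded {x | ψ x < 0}) (hne : (frontier {x | ψ x < 0}).Nonempty) :
    ∃ C, 0 < C ∧ ∀ z, ψ z < 0 → -ψ z ≤ C * infDist z (frontier {x | ψ x < 0}) := by
  have := FiniteDimensional.proper_real E
  obtain ⟨R, hR⟩ := hb.subset_closedBall 0
  obtain ⟨L, hL⟩ := hψ.contDiffOn.exists_lipschitzOnWith one_ne_zero
    (convex_closedBall (0 : E) R) (isCompact_closedBall (0 : E) R)
  refine ⟨L + 1, by positivity, fun z hz => ?_⟩
  obtain ⟨p, hp, hpd⟩ := isClosed_frontier.exists_infDist_eq_dist hne z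
  have hpR : p ∈ closedBall 0 R := closure_minimal hR isClosed_closedBall hp.1
  rw [hpd]
  calc -ψ z ≤ dist (ψ z) (ψ p) := by
        rw [eq_zero_of_mem_frontier_sublevel hψ.continuous hp, Real.dist_0_eq_abs]
        exact neg_le_abs (ψ z)
    _ ≤ L * dist z p := hL.dist_le_mul z (hR hz) p hpR
    _ ≤ (L + 1) * dist z p := by
      gcongr
      exact (lt_add_one _).le

theorem exists_measure_collar_le [MeasurableSpace E] [BorelSpace E] (μ : Measure E)
    [μ.IsAddLeftInvariant] [IsFiniteMeasureOnCompacts μ] (hψ : ContDiff ℝ 1 ψ)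
    (hreg : ∀ p ∈ frontier {x | ψ x < 0}, fderiv ℝ ψ p ≠ 0)
    (hb : Bornology.IsBounded {x | ψ x < 0}) :
    ∃ C : ℝ≥0, ∀ t, 0 < t → μ (ψ ⁻¹' Ioo (-t) 0) ≤ C * ENNReal.ofReal t := by
  have := FiniteDimensional.proper_real E
  suffices h : ∃ C : ℝ≥0, ∀ t, 0 < t →
      μ (closure {x | ψ x < 0} ∩ ψ ⁻¹' Ioo (-t) 0) ≤ C * ENNReal.ofReal t by
    obtain ⟨C, hC⟩ := h
    refine ⟨C, fun t ht => (measure_mono fun x hx => ?_).trans (hC t ht)⟩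
    exact ⟨subset_closure hx.2, hx⟩
  refine hb.isCompact_closure.induction_on ⟨0, by simp⟩ ?_ ?_ fun p hp => ?_
  · rintro s s' hss' ⟨C, hC⟩
    exact ⟨C, fun t ht => (measure_mono (inter_subset_inter_left _ hss')).trans (hC t ht)⟩
  · rintro s s' ⟨C, hC⟩ ⟨C', hC'⟩
    refine ⟨C + C', fun t ht => ?_⟩
    rw [union_inter_distrib_right, ENNReal.coe_add, add_mul]
    exact (measure_union_le _ _).trans (add_le_add (hC t ht) (hC' t ht))
  · rw [closure_eq_self_union_frontier] at hp
    rcases hp with hp | hp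
    · obtain ⟨s, hs, C, hC⟩ := exists_mem_nhds_measure_collar_le_of_neg μ hψ.continuous hp
      exact ⟨s, mem_nhdsWithin_of_mem_nhds hs, C, hC⟩
    · obtain ⟨g, r, hr, hg⟩ := exists_growsAlong_ball_of_contDiff hψ (hreg p hp)
      refine ⟨ball p r, mem_nhdsWithin_of_mem_nhds (ball_mem_nhds p hr),
        (μ (ball p (r + ‖g‖))).toNNReal, fun t ht => ?_⟩
      rw [ENNReal.coe_toNNReal measure_ball_lt_top.ne, mul_comm]
      simpa only [zero_sub, neg_neg] using
        hg.measure_inter_preimage_Ioo_le μ hψ.continuous.measurable (neg_lt_zero.2 ht)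

end SublevelSet

section Taylor

theorem norm_sub_sub_fderiv_le_of_lipschitzOnWith {E F : Type*} [NormedAddCommGroup E]
    [NormedSpace ℝ E] [NormedAddCommGroup F] [NormedSpace ℝ F] {f : E → F} {s : Set E} {K : ℝ≥0}
    (hs : Convex ℝ s) (hf : ∀ x ∈ s, DifferentiableAt ℝ f x)
    (hK : LipschitzOnWith K (fderiv ℝ f) s) {x y : E} (hx : x ∈ s) (hy : y ∈ s) :
    ‖f y - f x - fderiv ℝ f x (y - x)‖ ≤ K * ‖y - x‖ ^ 2 := by
  have hseg : segment ℝ x y ⊆ s := hs.segment_subset hx hy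
  have hderiv : ∀ w ∈ segment ℝ x y, ‖fderiv ℝ f w - fderiv ℝ f x‖ ≤ K * ‖y - x‖ := fun w hw => by
    rw [← dist_eq_norm]
    refine (hK.dist_le_mul w (hseg hw) x hx).trans ?_
    rw [dist_eq_norm]
    gcongr
    exact norm_sub_le_of_mem_segment hw
  rw [sq, ← mul_assoc]
  exact (convex_segment x y).norm_image_sub_le_of_norm_fderiv_le' (fun w hw => hf w (hseg hw))
    hderiv (left_mem_segment ℝ x y) (right_mem_segment ℝ x y)

end Taylor

section ComplexBox

variable {E : Type*} [NormedAddCommGroup E] [InnerProductSpace ℂ E] {z ν x : E} {r s : ℝ}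

/-- The anisotropic box around `z`, of size `r` in the complex direction `ν` and of size `√r` in the
directions orthogonal to it. When `ν` is the complex normal of a `C²` function at `z`, the function
varies by `O(r)` on it. -/
def complexBox (z ν : E) (r : ℝ) : Set E :=
  {x | ‖inner ℂ ν (x - z)‖ < r ∧ ‖x - z‖ ^ 2 < r}

theorem isOpen_complexBox (z ν : E) (r : ℝ) : IsOpen (complexBox z ν r) := by
  have hinner : Continuous fun x => ‖inner ℂ ν (x - z)‖ := by fun_prop
  have hnorm : Continuous fun x => ‖x - z‖ ^ 2 := by fun_prop
  exact (isOpen_lt hinner continuous_const).inter (isOpen_lt hnorm continuous_const)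

theorem self_mem_complexBox (hr : 0 < r) : z ∈ complexBox z ν r := by
  simpa [complexBox] using hr

theorem complexBox_mono (hsr : s ≤ r) : complexBox z ν s ⊆ complexBox z ν r :=
  fun _ hx => ⟨hx.1.trans_le hsr, hx.2.trans_le hsr⟩

theorem add_smul_sub_mem_complexBox {c : ℂ} (hc : ‖c‖ ≤ 1) (hx : x ∈ complexBox z ν r) :
    z + c • (x - z) ∈ complexBox z ν r := by
  simp only [complexBox, mem_ofPred_eq, add_sub_cancel_left, inner_smul_right, norm_mul, norm_smul,
    mul_pow]
  exact ⟨(mul_le_of_le_one_left (norm_nonneg _) hc).trans_lt hx.1,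
    (mul_le_of_le_one_left (by positivity) (pow_le_one₀ (norm_nonneg _) hc)).trans_lt hx.2⟩

theorem add_inv_smul_sub_mem_complexBox (hr : 0 < r) (hs : 0 < s) (hs1 : s ≤ 1)
    (hx : x ∈ complexBox z ν (s ^ 2 * r)) : z + (s : ℂ)⁻¹ • (x - z) ∈ complexBox z ν r := by
  simp only [complexBox, mem_ofPred_eq, add_sub_cancel_left, inner_smul_right, norm_mul, norm_smul,
    norm_inv, Complex.norm_real, Real.norm_of_nonneg hs.le, mul_pow, inv_pow]
  rw [inv_mul_lt_iff₀ hs, inv_mul_lt_iff₀ (by positivity)]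
  refine ⟨hx.1.trans_le ?_, hx.2⟩
  gcongr
  exact pow_le_of_le_one hs.le hs1 two_ne_zero

/-- The linear map that is multiplication by `q ^ 2` in the complex direction of the unit vector `ν`
and by `q` on its orthogonal complement. For `q = √r` it carries the unit ball into the box of
parameter `r`, which bounds the volume of the box from below. -/
noncomputable def boxDilation (ν : E) (q : ℝ) : E →ₗ[ℂ] E :=
  (q : ℂ) • LinearMap.transvection (innerₛₗ ℂ ν) (((q : ℂ) - 1) • ν)

theorem boxDilation_apply (ν : E) (q : ℝ) (x : E) :
    boxDilation ν q x = (q : ℂ) • (x + inner ℂ ν x • ((q : ℂ) - 1) • ν) := by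
  rw [boxDilation, LinearMap.smul_apply, LinearMap.transvection.apply, innerₛₗ_apply_apply]

theorem inner_boxDilation (hν : ‖ν‖ = 1) (q : ℝ) (x : E) :
    inner ℂ ν (boxDilation ν q x) = (q : ℂ) ^ 2 * inner ℂ ν x := by
  rw [boxDilation_apply, inner_smul_right, inner_add_right, inner_smul_right, inner_smul_right,
    inner_self_eq_norm_sq_to_K, hν]
  push_cast
  ring

theorem norm_boxDilation_le {q : ℝ} (hν : ‖ν‖ = 1) (hq : 0 ≤ q) (hq1 : q ≤ 1) (x : E) :
    ‖boxDilation ν q x‖ ≤ q * ‖x‖ := by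
  have hsplit : x + inner ℂ ν x • ((q : ℂ) - 1) • ν =
      (q : ℂ) • x + ((1 - q : ℝ) : ℂ) • (x - inner ℂ ν x • ν) := by
    push_cast
    module
  have hproj : ‖x - inner ℂ ν x • ν‖ ≤ ‖x‖ := by
    rw [← Submodule.starProjection_unit_singleton ℂ hν, ← Submodule.starProjection_orthogonal_val]
    exact Submodule.norm_starProjection_apply_le _ x
  rw [boxDilation_apply, norm_smul, Complex.norm_real, Real.norm_of_nonneg hq, hsplit]
  gcongr
  calc ‖(q : ℂ) • x + ((1 - q : ℝ) : ℂ) • (x - inner ℂ ν x • ν)‖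
    _ ≤ q * ‖x‖ + (1 - q) * ‖x - inner ℂ ν x • ν‖ := by
      refine (norm_add_le _ _).trans_eq ?_
      rw [norm_smul, norm_smul, Complex.norm_real, Complex.norm_real, Real.norm_of_nonneg hq,
        Real.norm_of_nonneg (sub_nonneg.2 hq1)]
    _ ≤ q * ‖x‖ + (1 - q) * ‖x‖ := by gcongr
    _ = ‖x‖ := by ring

theorem det_restrictScalars_boxDilation [FiniteDimensional ℂ E] (hν : ‖ν‖ = 1) (q : ℝ) :
    LinearMap.det ((boxDilation ν q).restrictScalars ℝ) = (q ^ 2) ^ (finrank ℂ E + 1) := by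
  have hdet : LinearMap.det (boxDilation ν q) = ((q ^ (finrank ℂ E + 1) : ℝ) : ℂ) := by
    rw [boxDilation, LinearMap.det_smul, LinearMap.transvection.det, innerₛₗ_apply_apply,
      inner_smul_right, inner_self_eq_norm_sq_to_K, hν]
    push_cast
    ring
  rw [LinearMap.det_restrictScalars, hdet, Algebra.norm_complex_apply, Complex.normSq_ofReal,
    ← mul_pow, sq]

theorem image_boxDilation_ball_subset (hν : ‖ν‖ = 1) (hr : 0 < r) (hr1 : r ≤ 1) :
    boxDilation ν √r '' ball 0 1 ⊆ complexBox 0 ν r := by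
  rintro _ ⟨x, hx, rfl⟩
  rw [mem_ball_zero_iff] at hx
  have hinner : ‖inner ℂ ν x‖ < 1 := by
    refine (norm_inner_le_norm ν x).trans_lt ?_
    rwa [hν, one_mul]
  rw [complexBox, mem_ofPred_eq, sub_zero]
  constructor
  · rw [inner_boxDilation hν, ← Complex.ofReal_pow, Real.sq_sqrt hr.le, norm_mul, Complex.norm_real,
      Real.norm_of_nonneg hr.le]
    exact mul_lt_of_lt_one_right hr hinner
  · calc ‖boxDilation ν √r x‖ ^ 2 ≤ (√r * ‖x‖) ^ 2 := by
          gcongr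
          exact norm_boxDilation_le hν (Real.sqrt_nonneg r) (Real.sqrt_le_one.2 hr1) x
      _ = r * ‖x‖ ^ 2 := by rw [mul_pow, Real.sq_sqrt hr.le]
      _ < r := mul_lt_of_lt_one_right hr (pow_lt_one₀ (norm_nonneg x) hx two_ne_zero)

theorem le_measure_complexBox [FiniteDimensional ℂ E] [MeasurableSpace E] [BorelSpace E]
    (μ : Measure E) [μ.IsAddHaarMeasure] (z : E) (hν : ‖ν‖ = 1) (hr : 0 < r) (hr1 : r ≤ 1) :
    ENNReal.ofReal (r ^ (finrank ℂ E + 1)) * μ (ball 0 1) ≤ μ (complexBox z ν r) := by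
  have hcenter : complexBox z ν r = (fun x => x + -z) ⁻¹' complexBox 0 ν r := by
    ext x
    simp only [complexBox, mem_preimage, mem_ofPred_eq, ← sub_eq_add_neg, sub_zero]
  calc ENNReal.ofReal (r ^ (finrank ℂ E + 1)) * μ (ball 0 1)
    _ = μ ((boxDilation ν √r).restrictScalars ℝ '' ball 0 1) := by
      rw [Measure.addHaar_image_linearMap, det_restrictScalars_boxDilation hν, Real.sq_sqrt hr.le,
        abs_of_nonneg (by positivity)]
    _ ≤ μ (complexBox 0 ν r) := measure_mono (image_boxDilation_ball_subset hν hr hr1)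
    _ = μ (complexBox z ν r) := by rw [hcenter, measure_preimage_add_right]

theorem exists_unit_abs_apply_le [CompleteSpace E] [Nontrivial E] (f : E →L[ℝ] ℝ) :
    ∃ ν : E, ‖ν‖ = 1 ∧ ∀ v, |f v| ≤ ‖f‖ * ‖inner ℂ ν v‖ := by
  set F : StrongDual ℂ E := StrongDual.extendRCLike f
  set w : E := (InnerProductSpace.toDual ℂ E).symm F
  have hw : ‖w‖ = ‖f‖ := by
    rw [LinearIsometryEquiv.norm_map, StrongDual.norm_extendRCLike]
  have hfw : ∀ v, |f v| ≤ ‖inner ℂ w v‖ := fun v => by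
    have hre : f v = (inner ℂ w v).re := by
      rw [InnerProductSpace.toDual_symm_apply, StrongDual.extendRCLike_apply]
      simp
    rw [hre]
    exact Complex.abs_re_le_norm _
  rcases eq_or_ne w 0 with hw0 | hw0
  · obtain ⟨ν, hν⟩ := exists_norm_eq E (zero_le_one (α := ℝ))
    refine ⟨ν, hν, fun v => (hfw v).trans ?_⟩
    rw [hw0, inner_zero_left, norm_zero]
    positivity
  · refine ⟨(‖w‖ : ℂ)⁻¹ • w, norm_smul_inv_norm hw0, fun v => (hfw v).trans_eq ?_⟩
    rw [inner_smul_left, norm_mul, ← hw, RCLike.norm_conj, norm_inv, Complex.norm_real, norm_norm,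
      mul_inv_cancel_left₀ (norm_ne_zero_iff.2 hw0)]

theorem exists_abs_sub_le_mul_of_mem_complexBox [FiniteDimensional ℂ E] [Nontrivial E] {ψ : E → ℝ}
    (hψ : ContDiff ℝ 2 ψ) {K : Set E} (hK : Bornology.IsBounded K) :
    ∃ C, 0 < C ∧ ∀ z ∈ K, ∃ ν : E, ‖ν‖ = 1 ∧
      ∀ r ≤ 1, ∀ x ∈ complexBox z ν r, |ψ x - ψ z| ≤ C * r := by
  have := FiniteDimensional.proper_real E
  have := FiniteDimensional.complete ℂ E
  have hψ' : ContDiff ℝ 1 (fderiv ℝ ψ) := hψ.fderiv_right (m := 1) (by norm_num)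
  obtain ⟨R, hR⟩ := hK.subset_closedBall 0
  obtain ⟨L, hL⟩ := (isCompact_closedBall (0 : E) (R + 1)).exists_bound_of_continuousOn
    hψ'.continuous.continuousOn
  obtain ⟨M, hM⟩ := hψ'.contDiffOn.exists_lipschitzOnWith one_ne_zero
    (convex_closedBall (0 : E) (R + 1)) (isCompact_closedBall 0 (R + 1))
  refine ⟨max L 0 + M + 1, by positivity, fun z hz => ?_⟩
  obtain ⟨ν, hν, hfν⟩ := exists_unit_abs_apply_le (fderiv ℝ ψ z)
  refine ⟨ν, hν, fun r hr x hx => ?_⟩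
  have hr0 : 0 < r := (norm_nonneg _).trans_lt hx.1
  have hzR := mem_closedBall_zero_iff.1 (hR hz)
  have hz' : z ∈ closedBall (0 : E) (R + 1) := by
    rw [mem_closedBall_zero_iff]
    linarith
  have hx' : x ∈ closedBall (0 : E) (R + 1) := by
    have : ‖x - z‖ ≤ 1 := (sq_le_one_iff₀ (norm_nonneg _)).1 (hx.2.le.trans hr)
    rw [mem_closedBall_zero_iff]
    linarith [norm_le_norm_add_norm_sub' x z]
  have htaylor := norm_sub_sub_fderiv_le_of_lipschitzOnWith (convex_closedBall 0 (R + 1))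
    (fun x _ => hψ.differentiable two_ne_zero x) hM hz' hx'
  have hlinear : |fderiv ℝ ψ z (x - z)| ≤ max L 0 * r :=
    (hfν (x - z)).trans (mul_le_mul ((hL z hz').trans (le_max_left L 0)) hx.1.le (norm_nonneg _)
      (le_max_right L 0))
  calc |ψ x - ψ z| ≤ |fderiv ℝ ψ z (x - z)| + |ψ x - ψ z - fderiv ℝ ψ z (x - z)| := by
        refine (abs_add_le _ _).trans_eq' ?_
        rw [add_sub_cancel]
    _ ≤ max L 0 * r + M * r := by
      gcongr
      exact htaylor.trans (by gcongr; exact hx.2.le)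
    _ ≤ (max L 0 + M + 1) * r := by linarith

end ComplexBox

section Kobayashi

theorem poincareDist_comm (ζ η : ℂ) : poincareDist ζ η = poincareDist η ζ := by
  have hconj : 1 - (starRingEnd ℂ) ζ * η = (starRingEnd ℂ) (1 - (starRingEnd ℂ) η * ζ) := by
    rw [map_sub, map_one, map_mul, Complex.conj_conj, mul_comm]
  rw [poincareDist, poincareDist, norm_div, norm_div, hconj, RCLike.norm_conj, norm_sub_rev]

variable {n : ℕ} {D : Set (EuclideanSpace ℂ (Fin n))} {z w x ν ν' : EuclideanSpace ℂ (Fin n)}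
  {r r' s : ℝ}

theorem lempertFunction_le {φ : ℂ → EuclideanSpace ℂ (Fin n)} {ζ η : ℂ}
    (hφ : DifferentiableOn ℂ φ (ball 0 1)) (hmaps : MapsTo φ (ball 0 1) D)
    (hζ : ζ ∈ ball (0 : ℂ) 1) (hη : η ∈ ball (0 : ℂ) 1) :
    lempertFunction D (φ ζ) (φ η) ≤ ENNReal.ofReal (poincareDist ζ η) :=
  iInf_le_of_le φ <| iInf_le_of_le ζ <| iInf_le_of_le η <| iInf_le_of_le hφ <|
    iInf_le_of_le hmaps <| iInf_le_of_le hζ <| iInf_le_of_le hη <| iInf_le_of_le rfl <|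
      iInf_le_of_le rfl le_rfl

theorem lempertFunction_comm (D : Set (EuclideanSpace ℂ (Fin n)))
    (z w : EuclideanSpace ℂ (Fin n)) : lempertFunction D z w = lempertFunction D w z := by
  suffices h : ∀ z w, lempertFunction D z w ≤ lempertFunction D w z from le_antisymm (h z w) (h w z)
  intro z w
  refine le_iInf fun φ => le_iInf fun ζ => le_iInf fun η => le_iInf fun hφ => le_iInf fun hmaps =>
    le_iInf fun hζ => le_iInf fun hη => le_iInf fun hw => le_iInf fun hz => ?_
  rw [← hw, ← hz, poincareDist_comm]
  exact lempertFunction_le hφ hmaps hη hζ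

theorem lempertFunction_add_smul_le {v : EuclideanSpace ℂ (Fin n)} (hs : 0 ≤ s) (hs1 : s < 1)
    (hdisc : ∀ ζ : ℂ, ‖ζ‖ < 1 → z + ζ • v ∈ D) :
    lempertFunction D z (z + (s : ℂ) • v) ≤ ENNReal.ofReal (Real.artanh s) := by
  have hmaps : MapsTo (fun ζ : ℂ => z + ζ • v) (ball 0 1) D := fun ζ hζ =>
    hdisc ζ (mem_ball_zero_iff.1 hζ)
  have hs_mem : (s : ℂ) ∈ ball (0 : ℂ) 1 := by simpa [abs_of_nonneg hs] using hs1
  simpa [poincareDist, abs_of_nonneg hs] using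
    lempertFunction_le (by fun_prop) hmaps (mem_ball_self one_pos) hs_mem

theorem lempertFunction_le_of_mem_complexBox (hr : 0 < r) (hs : 0 < s) (hs1 : s < 1)
    (hsub : complexBox z ν r ⊆ D) (hx : x ∈ complexBox z ν (s ^ 2 * r)) :
    lempertFunction D z x ≤ ENNReal.ofReal (Real.artanh s) := by
  have hdilated := add_inv_smul_sub_mem_complexBox hr hs hs1.le hx
  have hs0 : (s : ℂ) ≠ 0 := Complex.ofReal_ne_zero.2 hs.ne'
  have hx_eq : x = z + (s : ℂ) • (s : ℂ)⁻¹ • (x - z) := by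
    rw [smul_inv_smul₀ hs0, add_sub_cancel]
  rw [hx_eq]
  refine lempertFunction_add_smul_le hs.le hs1 fun ζ hζ => hsub ?_
  simpa only [add_sub_cancel_left] using add_smul_sub_mem_complexBox hζ.le hdilated

theorem kobayashiEDist_self (hz : z ∈ D) : kobayashiEDist D z z = 0 :=
  le_antisymm (iInf_le_of_le 0 <| iInf_le_of_le (fun _ => z) <| iInf_le_of_le (fun _ => hz) <|
    iInf_le_of_le rfl <| iInf_le_of_le rfl (by simp)) zero_le

theorem rhoDist_self (hz : z ∈ D) : rhoDist D z z = 0 := by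
  rw [rhoDist, kobayashiDist, kobayashiEDist_self hz, ENNReal.toReal_zero, Real.tanh_zero]

theorem kobayashiEDist_le_add (hz : z ∈ D) (hx : x ∈ D) (hw : w ∈ D) :
    kobayashiEDist D z w ≤ lempertFunction D z x + lempertFunction D x w := by
  refine iInf_le_of_le 2 <| iInf_le_of_le
    (fun i => if i = 0 then z else if i = 1 then x else w) <| iInf_le_of_le (fun i => ?_) <|
    iInf_le_of_le (by simp) <| iInf_le_of_le (by simp) (by simp [Finset.sum_range_succ])
  dsimp only
  split_ifs <;> assumption

theorem disjoint_complexBox_of_lt_kobayashiDist (hr : 0 < r) (hr' : 0 < r') (hs : 0 < s)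
    (hs1 : s < 1) (hsub : complexBox z ν r ⊆ D) (hsub' : complexBox w ν' r' ⊆ D)
    (hzw : 2 * Real.artanh s < kobayashiDist D z w) :
    Disjoint (complexBox z ν (s ^ 2 * r)) (complexBox w ν' (s ^ 2 * r')) := by
  refine Set.disjoint_left.2 fun x hx hx' => hzw.not_ge ?_
  have hartanh : 0 ≤ Real.artanh s := (Real.artanh_pos ⟨hs, hs1⟩).le
  have hxD : x ∈ D := hsub (complexBox_mono
    (mul_le_of_le_one_left hr.le (pow_le_one₀ hs.le hs1.le)) hx)
  refine ENNReal.toReal_le_of_le_ofReal (by positivity) ?_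
  calc kobayashiEDist D z w
    _ ≤ lempertFunction D z x + lempertFunction D w x := by
      rw [lempertFunction_comm D w x]
      exact kobayashiEDist_le_add (hsub (self_mem_complexBox hr)) hxD
        (hsub' (self_mem_complexBox hr'))
    _ ≤ ENNReal.ofReal (Real.artanh s) + ENNReal.ofReal (Real.artanh s) :=
      add_le_add (lempertFunction_le_of_mem_complexBox hr hs hs1 hsub hx)
        (lempertFunction_le_of_mem_complexBox hr' hs hs1 hsub' hx')
    _ = ENNReal.ofReal (2 * Real.artanh s) := by
      rw [← ENNReal.ofReal_add hartanh hartanh, two_mul]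

theorem IsUniformlyDiscrete.injective {X ι : Type*} {d : X → X → ℝ} {x : ι → X}
    (hx : IsUniformlyDiscrete d x) (hd : ∀ j, d (x j) (x j) = 0) : Function.Injective x := by
  obtain ⟨δ, hδ, hsep⟩ := hx
  intro j k hjk
  by_contra hne
  have hle := hsep j k hne
  rw [← hjk, hd] at hle
  exact hle.not_gt hδ

theorem IsUniformlyDiscrete.kobayashiDist_of_rhoDist {ι : Type*}
    {z : ι → EuclideanSpace ℂ (Fin n)} (hz : IsUniformlyDiscrete (rhoDist D) z) :
    IsUniformlyDiscrete (kobayashiDist D) z := by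
  obtain ⟨δ, hδ, hsep⟩ := hz
  have hpos : 0 < min δ (1 / 2) := by positivity
  have hlt : min δ (1 / 2) < 1 := (min_le_right δ (1 / 2)).trans_lt one_half_lt_one
  refine ⟨Real.artanh (min δ (1 / 2)), Real.artanh_pos ⟨hpos, hlt⟩, fun j k hjk => ?_⟩
  rw [← Real.artanh_tanh (kobayashiDist D (z j) (z k))]
  exact Real.artanh_le_artanh (by linarith) (Real.tanh_lt_one _)
    ((min_le_left δ (1 / 2)).trans (hsep j k hjk))

theorem exists_two_mul_artanh_lt {κ : ℝ} (hκ : 0 < κ) :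
    ∃ s : ℝ, 0 < s ∧ s < 1 ∧ 2 * Real.artanh s < κ := by
  refine ⟨Real.tanh (κ / 3), ?_, Real.tanh_lt_one _, ?_⟩
  · rw [Real.tanh_eq_sinh_div_cosh]
    exact div_pos (Real.sinh_pos_iff.2 (by positivity)) (Real.cosh_pos _)
  · rw [Real.artanh_tanh]
    linarith

end Kobayashi

section Summation

variable {ι κ : Type*}

theorem finite_of_card_mul_le {S : Set ι} {w K : ℝ} (hw : 0 < w)
    (hcard : ∀ F : Finset ι, (F : Set ι) ⊆ S → F.card * w ≤ K) : S.Finite := by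
  by_contra hS
  obtain ⟨F, hF, hFcard⟩ := Set.Infinite.exists_subset_card_eq hS (⌊K / w⌋₊ + 1)
  have hle : (F.card : ℝ) ≤ K / w := (le_div_iff₀ hw).2 (hcard F hF)
  rw [hFcard] at hle
  push_cast at hle
  exact hle.not_gt (Nat.lt_floor_add_one _)

theorem summable_mul_comp_of_card_mul_le {m : ι → κ} {w H : κ → ℝ} {K : ℝ} (hw : ∀ k, 0 ≤ w k)
    (hH : ∀ k, 0 ≤ H k) (hsum : Summable H)
    (hcard : ∀ (k : κ) (F : Finset ι), (∀ j ∈ F, m j = k) → F.card * w k ≤ K) :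
    Summable fun j => w (m j) * H (m j) := by
  classical
  have hK : ∀ _ : κ, 0 ≤ K := fun k => by simpa using hcard k ∅ (by simp)
  refine summable_of_sum_le (c := ∑' k, K * H k) (fun j => mul_nonneg (hw _) (hH _)) fun F => ?_
  rw [← Finset.sum_fiberwise_of_maps_to (fun j hj => Finset.mem_image_of_mem m hj)]
  calc ∑ k ∈ F.image m, ∑ j ∈ F with m j = k, w (m j) * H (m j)
    _ = ∑ k ∈ F.image m, (Finset.card {j ∈ F | m j = k} * w k) * H k := by
      refine Finset.sum_congr rfl fun k _ => ?_
      rw [Finset.sum_congr rfl fun j hj => by rw [(Finset.mem_filter.1 hj).2], Finset.sum_const,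
        nsmul_eq_mul, mul_assoc]
    _ ≤ ∑ k ∈ F.image m, K * H k := Finset.sum_le_sum fun k _ =>
      mul_le_mul_of_nonneg_right (hcard k _ fun j hj => (Finset.mem_filter.1 hj).2) (hH k)
    _ ≤ ∑' k, K * H k :=
      (hsum.mul_left K).sum_le_tsum _ fun k _ => mul_nonneg (hK k) (hH k)

theorem exp_neg_floor_neg_log_bounds {d : ℝ} (hd : 0 < d) (hd1 : d < 1) :
    Real.exp (-1) * Real.exp (-⌊-Real.log d⌋₊) ≤ d ∧ d ≤ Real.exp (-⌊-Real.log d⌋₊) := by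
  constructor
  · rw [← Real.exp_add, ← Real.le_log_iff_exp_le hd]
    linarith [Nat.lt_floor_add_one (-Real.log d)]
  · rw [← Real.log_le_iff_le_exp hd]
    linarith [Nat.floor_le (neg_nonneg.2 (Real.log_neg hd hd1).le)]

/-- The shells `e⁻⁽ᵏ⁺¹⁾ < d ≤ e⁻ᵏ` with `k ≥ 1` contribute at most `K * h (1 / k)` each, and the
shell `k = 0`, where `h` may be unbounded, contains only finitely many points. -/
theorem summable_pow_mul_of_card_shell_le {d : ι → ℝ} {n : ℕ} {K : ℝ} (hd0 : ∀ j, 0 < d j)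
    (hd1 : ∀ j, d j < 1)
    (hcard : ∀ t, 0 < t → ∀ F : Finset ι, (∀ j ∈ F, Real.exp (-1) * t ≤ d j ∧ d j ≤ t) →
      F.card * t ^ n ≤ K)
    {h : ℝ → ℝ} (h_nonneg : ∀ t, 0 < t → 0 ≤ h t) (h_mono : MonotoneOn h (Ioi 0))
    (h_sum : Summable fun m : ℕ => h (1 / ((m : ℝ) + 1))) :
    Summable fun j => d j ^ n * h (-(1 / Real.log (d j))) := by
  set shell : ι → ℕ := fun j => ⌊-Real.log (d j)⌋₊
  set H : ℕ → ℝ := fun k => h (1 / (((k - 1 : ℕ) : ℝ) + 1))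
  have hlog : ∀ j, 0 < -Real.log (d j) := fun j => neg_pos.2 (Real.log_neg (hd0 j) (hd1 j))
  have hshell_card : ∀ (k : ℕ) (F : Finset ι), (∀ j ∈ F, shell j = k) →
      F.card * Real.exp (-k) ^ n ≤ K := by
    intro k F hF
    refine hcard _ (Real.exp_pos _) F fun j hj => ?_
    rw [← hF j hj]
    exact exp_neg_floor_neg_log_bounds (hd0 j) (hd1 j)
  have hH : Summable H := by
    rw [← summable_nat_add_iff 1]
    simpa only [H, Nat.add_sub_cancel] using h_sum
  have hbound : Summable fun j => Real.exp (-shell j) ^ n * H (shell j) :=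
    summable_mul_comp_of_card_mul_le (w := fun k : ℕ => Real.exp (-k) ^ n)
      (fun k => by positivity) (fun k => h_nonneg _ (by positivity)) hH hshell_card
  have hfinite : {j | shell j = 0}.Finite :=
    finite_of_card_mul_le (by positivity) fun F hF => hshell_card 0 F hF
  refine hbound.of_norm_bounded_eventually ?_
  filter_upwards [hfinite.compl_mem_cofinite] with j hj
  have hshell_pos : 0 < shell j := Nat.pos_of_ne_zero hj
  have hshell_le : ((shell j - 1 : ℕ) : ℝ) + 1 ≤ -Real.log (d j) := by
    rw [← Nat.cast_add_one, Nat.sub_add_cancel hshell_pos]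
    exact Nat.floor_le (hlog j).le
  have harg : 0 < 1 / -Real.log (d j) := one_div_pos.2 (hlog j)
  rw [← one_div_neg_eq_neg_one_div, Real.norm_of_nonneg
    (mul_nonneg (pow_nonneg (hd0 j).le n) (h_nonneg _ harg))]
  refine mul_le_mul (pow_le_pow_left₀ (hd0 j).le
    (exp_neg_floor_neg_log_bounds (hd0 j) (hd1 j)).2 n) ?_ (h_nonneg _ harg) (by positivity)
  exact h_mono harg (mem_Ioi.2 (by positivity)) (one_div_le_one_div_of_le (by positivity) hshell_le)

end Summation

section Counting

theorem exists_complexBox_subset_preimage_Ioo {E : Type*} [NormedAddCommGroup E]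
    [InnerProductSpace ℂ E] [FiniteDimensional ℂ E] [Nontrivial E] {ψ : E → ℝ}
    (hψ : ContDiff ℝ 2 ψ) (hb : Bornology.IsBounded {x | ψ x < 0}) :
    ∃ ε, 0 < ε ∧ ∀ z, ψ z < 0 → ε * -ψ z ≤ 1 ∧
      ∃ ν : E, ‖ν‖ = 1 ∧ complexBox z ν (ε * -ψ z) ⊆ ψ ⁻¹' Ioo (2 * ψ z) 0 := by
  have := FiniteDimensional.proper_real E
  obtain ⟨C, hC, hbox⟩ := exists_abs_sub_le_mul_of_mem_complexBox hψ hb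
  obtain ⟨M, hM⟩ := hb.isCompact_closure.exists_bound_of_continuousOn hψ.continuous.continuousOn
  refine ⟨(C + |M| + 1)⁻¹, by positivity, fun z hz => ?_⟩
  have hψM : -ψ z ≤ |M| :=
    (neg_le_abs (ψ z)).trans ((hM z (subset_closure hz)).trans (le_abs_self M))
  have hle : (C + |M| + 1)⁻¹ * -ψ z ≤ 1 := by
    rw [inv_mul_le_one₀ (by positivity)]
    linarith
  have hlt : C * ((C + |M| + 1)⁻¹ * -ψ z) < -ψ z := by
    rw [← mul_assoc, ← div_eq_mul_inv]
    refine mul_lt_of_lt_one_left (neg_pos.2 hz) ((div_lt_one (by positivity)).2 ?_)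
    linarith [abs_nonneg M]
  obtain ⟨ν, hν, hνbox⟩ := hbox z hz
  refine ⟨hle, ν, hν, fun x hx => ?_⟩
  have hx' := abs_lt.1 ((hνbox _ hle x hx).trans_lt hlt)
  exact ⟨by linarith, by linarith⟩

variable {n : ℕ} {ψ : EuclideanSpace ℂ (Fin n) → ℝ} {ι : Type*} {z : ι → EuclideanSpace ℂ (Fin n)}

theorem exists_pairwise_disjoint_complexBox [NeZero n] (hψ : ContDiff ℝ 2 ψ)
    (hb : Bornology.IsBounded {x | ψ x < 0}) (hzψ : ∀ j, ψ (z j) < 0)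
    (hz : IsUniformlyDiscrete (kobayashiDist {x | ψ x < 0}) z) :
    ∃ c, 0 < c ∧ ∃ ν : ι → EuclideanSpace ℂ (Fin n),
      (∀ j, ‖ν j‖ = 1 ∧ c * -ψ (z j) ≤ 1 ∧
        complexBox (z j) (ν j) (c * -ψ (z j)) ⊆ ψ ⁻¹' Ioo (2 * ψ (z j)) 0) ∧
      Pairwise fun j k => Disjoint (complexBox (z j) (ν j) (c * -ψ (z j)))
        (complexBox (z k) (ν k) (c * -ψ (z k))) := by
  obtain ⟨κ, hκ, hsep⟩ := hz
  obtain ⟨s, hs, hs1, hsκ⟩ := exists_two_mul_artanh_lt hκ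
  obtain ⟨ε, hε, hbox⟩ := exists_complexBox_subset_preimage_Ioo hψ hb
  choose hε1 ν hν hsub using fun j => hbox (z j) (hzψ j)
  have hpos : ∀ j, 0 < ε * -ψ (z j) := fun j => mul_pos hε (neg_pos.2 (hzψ j))
  have hshrink : ∀ j, s ^ 2 * (ε * -ψ (z j)) ≤ ε * -ψ (z j) := fun j =>
    mul_le_of_le_one_left (hpos j).le (pow_le_one₀ hs.le hs1.le)
  have hsub_sublevel : ∀ j, complexBox (z j) (ν j) (ε * -ψ (z j)) ⊆ {x | ψ x < 0} := fun j x hx =>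
    (hsub j hx).2
  refine ⟨s ^ 2 * ε, by positivity, ν, fun j => ⟨hν j, ?_, ?_⟩, fun j k hjk => ?_⟩
  · rw [mul_assoc]
    exact (hshrink j).trans (hε1 j)
  · rw [mul_assoc]
    exact (complexBox_mono (hshrink j)).trans (hsub j)
  · simp only [mul_assoc]
    exact disjoint_complexBox_of_lt_kobayashiDist (hpos j) (hpos k) hs hs1 (hsub_sublevel j)
      (hsub_sublevel k) (hsκ.trans_le (hsep j k hjk))

theorem exists_card_mul_pow_le [NeZero n] (hψ : ContDiff ℝ 2 ψ)
    (hreg : ∀ p ∈ frontier {x | ψ x < 0}, fderiv ℝ ψ p ≠ 0)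
    (hb : Bornology.IsBounded {x | ψ x < 0}) (hzψ : ∀ j, ψ (z j) < 0)
    (hz : IsUniformlyDiscrete (kobayashiDist {x | ψ x < 0}) z) {a b : ℝ} (ha : 0 < a)
    (hb0 : 0 < b) :
    ∃ K : ℝ, ∀ t, 0 < t → ∀ F : Finset ι,
      (∀ j ∈ F, a * t ≤ -ψ (z j) ∧ -ψ (z j) ≤ b * t) → F.card * t ^ n ≤ K := by
  obtain ⟨c, hc, ν, hbox, hdisj⟩ := exists_pairwise_disjoint_complexBox hψ hb hzψ hz
  obtain ⟨C, hC⟩ := exists_measure_collar_le volume (hψ.of_le one_le_two) hreg hb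
  set V : ℝ := (volume (ball (0 : EuclideanSpace ℂ (Fin n)) 1)).toReal
  have hV : 0 < V := ENNReal.toReal_pos (measure_ball_pos _ _ one_pos).ne' measure_ball_lt_top.ne
  refine ⟨C * (2 * b) / ((c * a) ^ (n + 1) * V), fun t ht F hF => ?_⟩
  have hvolume : ∀ j ∈ F, ENNReal.ofReal ((c * (a * t)) ^ (n + 1) * V) ≤
      volume (complexBox (z j) (ν j) (c * -ψ (z j))) := by
    intro j hj
    have hpos : 0 < c * -ψ (z j) := mul_pos hc (neg_pos.2 (hzψ j))
    refine le_trans ?_ (le_measure_complexBox volume (z j) (hbox j).1 hpos (hbox j).2.1)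
    rw [finrank_euclideanSpace_fin, ENNReal.ofReal_mul (by positivity),
      ENNReal.ofReal_toReal measure_ball_lt_top.ne]
    gcongr
    exact (hF j hj).1
  have hcollar : ∀ j ∈ F, complexBox (z j) (ν j) (c * -ψ (z j)) ⊆ ψ ⁻¹' Ioo (-(2 * (b * t))) 0 :=
    fun j hj => (hbox j).2.2.trans
      (preimage_mono (Ioo_subset_Ioo_left (by linarith [(hF j hj).2])))
  have hpacking := (card_mul_le_measure_of_pairwiseDisjoint
    (fun j _ => (isOpen_complexBox _ _ _).measurableSet) (hdisj.set_pairwise _) hcollar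
    hvolume).trans (hC _ (by positivity))
  rw [← ENNReal.ofReal_natCast, ← ENNReal.ofReal_coe_nnreal, ← ENNReal.ofReal_mul (by positivity),
    ← ENNReal.ofReal_mul (by positivity), ENNReal.ofReal_le_ofReal_iff (by positivity)] at hpacking
  rw [le_div_iff₀ (by positivity)]
  refine le_of_mul_le_mul_right ?_ ht
  calc F.card * t ^ n * ((c * a) ^ (n + 1) * V) * t = F.card * ((c * (a * t)) ^ (n + 1) * V) := by
        ring
    _ ≤ C * (2 * (b * t)) := hpacking
    _ = C * (2 * b) * t := by ring

theorem exists_card_mul_infDist_frontier_pow_le [NeZero n] (hψ : ContDiff ℝ 2 ψ)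
    (hreg : ∀ p ∈ frontier {x | ψ x < 0}, fderiv ℝ ψ p ≠ 0)
    (hb : Bornology.IsBounded {x | ψ x < 0}) (hne : (frontier {x | ψ x < 0}).Nonempty)
    (hzψ : ∀ j, ψ (z j) < 0) (hz : IsUniformlyDiscrete (kobayashiDist {x | ψ x < 0}) z)
    {a : ℝ} (ha : 0 < a) :
    ∃ K : ℝ, ∀ t, 0 < t → ∀ F : Finset ι,
      (∀ j ∈ F, a * t ≤ infDist (z j) (frontier {x | ψ x < 0}) ∧
        infDist (z j) (frontier {x | ψ x < 0}) ≤ t) → F.card * t ^ n ≤ K := by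
  have hψ1 : ContDiff ℝ 1 ψ := hψ.of_le one_le_two
  obtain ⟨A, hA, hdist_le⟩ := exists_infDist_frontier_le_mul_neg hψ1 hreg hb
  obtain ⟨B, hB, hle_dist⟩ := exists_neg_le_mul_infDist_frontier hψ1 hb hne
  obtain ⟨K, hK⟩ := exists_card_mul_pow_le hψ hreg hb hzψ hz (div_pos ha hA) hB
  refine ⟨K, fun t ht F hF => hK t ht F fun j hj => ⟨?_, ?_⟩⟩
  · rw [div_mul_eq_mul_div, div_le_iff₀' hA]
    exact (hF j hj).1.trans (hdist_le _ (hzψ j))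
  · exact (hle_dist _ (hzψ j)).trans (by gcongr; exact (hF j hj).2)

end Counting

theorem theorem3p6_general {n : ℕ} {D : Set (EuclideanSpace ℂ (Fin n))}
    {ψ : EuclideanSpace ℂ (Fin n) → ℝ} (hψ : IsDefiningFunction ψ D) (hb : Bornology.IsBounded D)
    {ι : Type*} {z : ι → EuclideanSpace ℂ (Fin n)} (hzD : ∀ j, z j ∈ D)
    (hz : IsUniformlyDiscrete (rhoDist D) z) (hz1 : ∀ j, infDist (z j) (frontier D) < 1)
    {h : ℝ → ℝ} (h_nonneg : ∀ t, 0 < t → 0 ≤ h t) (h_mono : MonotoneOn h (Ioi 0))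
    (h_sum : Summable fun m : ℕ => h (1 / ((m : ℝ) + 1))) :
    Summable fun j : ι =>
      infDist (z j) (frontier D) ^ n * h (-(1 / Real.log (infDist (z j) (frontier D)))) := by
  obtain rfl | _ := eq_zero_or_neZero n
  · have := Finite.of_injective z (hz.injective fun j => rhoDist_self (hzD j))
    exact .of_finite
  obtain _ | ⟨⟨i⟩⟩ := isEmpty_or_nonempty ι
  · exact .of_finite
  obtain ⟨hψ2, rfl, hreg⟩ := hψ
  have hne : (frontier {x | ψ x < 0}).Nonempty := nonempty_frontier_of_isBounded ⟨z i, hzD i⟩ hb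
  have hopen : IsOpen {x | ψ x < 0} := isOpen_lt hψ2.continuous continuous_const
  obtain ⟨K, hcard⟩ := exists_card_mul_infDist_frontier_pow_le hψ2 hreg hb hne hzD
    hz.kobayashiDist_of_rhoDist (Real.exp_pos (-1))
  exact summable_pow_mul_of_card_shell_le (fun j => infDist_frontier_pos hopen hne (hzD j)) hz1
    hcard h_nonneg h_mono h_sum

theorem theorem3p6 {n : ℕ} (D : Set (EuclideanSpace ℂ (Fin n)))
    (hD : IsBoundedStronglyPseudoconvexDomain D)
    {ι : Type*} [Countable ι] (z : ι → EuclideanSpace ℂ (Fin n)) (hzD : ∀ j, z j ∈ D)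
    (hz : IsUniformlyDiscrete (rhoDist D) z)
    (hz1 : ∀ j, Metric.infDist (z j) (frontier D) < 1)
    (h : ℝ → ℝ) (h_nonneg : ∀ t, 0 < t → 0 ≤ h t) (h_mono : MonotoneOn h (Set.Ioi 0))
    (h_sum : Summable fun m : ℕ => h (1 / ((m : ℝ) + 1))) :
    Summable fun j : ι =>
      Metric.infDist (z j) (frontier D) ^ n *
        h (-(1 / Real.log (Metric.infDist (z j) (frontier D)))) := by
  obtain ⟨ψ, hψ, -⟩ := hD.exists_defining
  exact theorem3p6_general hψ hD.isBounded hzD hz hz1 h_nonneg h_mono h_sum
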